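/- For a real $m\times N$ matrix $\Phi$ and an integer $t\ge 0$ let $\delta_t(\Phi)$ be the smallest $\delta\ge 0$ with $(1-\delta)\|f\|_2^2\le\|\Phi f\|_2^2\le(1+\delta)\|f\|_2^2$ for all $t$-sparse $f\in\mathbb R^N$ (vectors with at most $t$ nonzero entries). Say that $\Phi$ has the scale-invariant restricted isometry property of order $t$ with distortion $D$ if there is $c>0$ such that $c\|\Phi f\|_2\le\|f\|_2\le cD\|\Phi f\|_2$ for all $t$-sparse $f\in\mathbb R^N$. **Theorem.** (1) (Random dense matrices.) For every $\delta\in[0,1)$ there is a constant $C>0$ depending only on $\delta$ such that the following holds for all $m,N,s$. Let $\Phi$ be a random $m\times N$ matrix with independent $\mathcal N(0,v)$ entries, where $v>0$ is arbitrary. If $\delta_{2s}(\Phi)\le\delta$ with positive probability, then $$m\ \ge\ C\,s\log(N/s).$$ (In particular this applies to the condition $\delta_{2s}(\Phi)<\sqrt2-1$, under which every $s$-sparse vector is perfectly recovered by $\ell_1$-minimization, with an absolute constant $C$.) Likewise, for every real $D$ there is a constant $C>0$ depending only on $D$ such that, if such a $\Phi$ has the scale-invariant restricted isometry property of order $2s$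 with distortion $D$ with positive probability, then $m\ge C\,s\log(N/s)$. (2) (Count-Min type matrices.) Let $\Phi$ be an $m\times N$ matrix with entries in $\{0,1\}$ and exactly $k$ ones in every column, and suppose that $\Phi$ has the scale-invariant restricted isometry property of order $s$ with distortion $D$. Then $$m\ \ge\ \min\Bigl\{\frac{s^2}{D^4},\ \frac{N}{D^2}\Bigr\};$$ in particular $m\ge s^2/D^4$ whenever $s^2\le D^2N$. (For $s=0$ or $N=0$ the lower bounds are read as $0$.) -/

import Mathlib

open MeasureTheory ProbabilityTheory
open scoped Matrix NNReal

/-- The Euclidean norm `‖x‖₂` of a real vector. -/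
noncomputable def l2norm {n : ℕ} (x : Fin n → ℝ) : ℝ := ‖WithLp.toLp 2 x‖

/-- A vector is `s`-sparse if it has at most `s` non-zero entries. -/
def IsSparse {N : ℕ} (s : ℕ) (f : Fin N → ℝ) : Prop := (Function.support f).ncard ≤ s

/-- The `s`-th restricted isometry constant `δ_s(Φ)`: the smallest `δ ≥ 0` such that
`(1 - δ) ‖f‖₂² ≤ ‖Φ f‖₂² ≤ (1 + δ) ‖f‖₂²` for all `s`-sparse vectors `f`. -/
noncomputable def ric {m N : ℕ} (Φ : Matrix (Fin m) (Fin N) ℝ) (s : ℕ) : ℝ :=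
  sInf {δ : ℝ | 0 ≤ δ ∧ ∀ f : Fin N → ℝ, IsSparse s f →
    (1 - δ) * l2norm f ^ 2 ≤ l2norm (Φ *ᵥ f) ^ 2 ∧
      l2norm (Φ *ᵥ f) ^ 2 ≤ (1 + δ) * l2norm f ^ 2}

/-- The scale-invariant restricted isometry property of order `s` with distortion `D`: for some
`c > 0`, `c ‖Φ f‖₂ ≤ ‖f‖₂ ≤ c D ‖Φ f‖₂` for all `s`-sparse vectors `f`. -/
def HasRIP {m N : ℕ} (Φ : Matrix (Fin m) (Fin N) ℝ) (s : ℕ) (D : ℝ) : Prop :=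
  ∃ c : ℝ, 0 < c ∧ ∀ f : Fin N → ℝ, IsSparse s f →
    c * l2norm (Φ *ᵥ f) ≤ l2norm f ∧ l2norm f ≤ c * D * l2norm (Φ *ᵥ f)

/-- A random real `m × N` matrix whose entries are independent centred Gaussian variables of
common variance `v > 0`. -/
structure IsGaussianMatrix {Ω : Type*} [MeasurableSpace Ω] (P : Measure Ω) {m N : ℕ}
    (Φ : Ω → Matrix (Fin m) (Fin N) ℝ) (v : ℝ≥0) : Prop where
  variance_pos : 0 < v
  entry_law : ∀ (i : Fin m) (j : Fin N), HasLaw (fun ω => Φ ω i j) (gaussianReal 0 v) P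
  indep : iIndepFun (fun (p : Fin m × Fin N) (ω : Ω) => Φ ω p.1 p.2) P

/-- A Count-Min type matrix: all entries are `0` or `1`, and every column has exactly `k` ones. -/
structure IsCountMinMatrix {m N : ℕ} (Φ : Matrix (Fin m) (Fin N) ℝ) (k : ℕ) : Prop where
  zero_or_one : ∀ (i : Fin m) (j : Fin N), Φ i j = 0 ∨ Φ i j = 1
  ones_in_column : ∀ j : Fin N, {i : Fin m | Φ i j = 1}.ncard = k

/-!
The restricted isometry property forces many rows on every matrix, so the randomness of `Φ` plays
no role in the first two bounds: an event of positive probability contains an outcome, and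
`δ₂ₛ < δ' < 1` gives the scale-invariant restricted isometry property with distortion
`√((1 + δ') / (1 - δ'))` (`hasRIP_of_ric_lt`), applied with `δ' = (1 + δ) / 2`.

For a fixed matrix with distortion `D` and order `2s`, cut out `s` disjoint blocks of
`q = ⌊N / s⌋` coordinates. Words of length `s` over `q` letters give `s`-sparse indicator vectors,
and a Gilbert–Varshamov code (`exists_code`) gives at least `(q / 4) ^ (s / 2)` of them at mutual
distance at least `√(s / 2)`. Their differences are `2s`-sparse, so `Φ` maps them to points of
`ℝ ^ m` in a ball of radius `√s / c` at mutual distance at least `√(s / 2) / (c D)`. By volume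
(`card_le_of_norm_le_of_separated`) there are at most `(1 + 3 D) ^ m` of these, which is the bound
when `N / s` is large. For bounded `N / s`, injectivity on `s` coordinates gives `s ≤ m`, which is
enough (`HasRIP.mul_log_le`).

For a Count-Min matrix, unit vectors fix the scale: `‖Φ 1_T‖² ≤ D² k |T|` whenever `|T| ≤ s`. Since
`‖Φ 1_T‖₁ = k |T|`, Cauchy–Schwarz gives `m ≥ k |T| / D²`. If `N ≤ s`, take
`|T| = N`. If `s < N` and `s ≤ D² k`, this with `|T| = s`
yields `m ≥ s² / D⁴`. Otherwise, testing on the columns that meet a given row shows that every row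
has at most `D² k` ones, and counting the `k N` ones by rows yields `m ≥ N / D²`
(`IsCountMinMatrix.min_le`).
-/

/-! ### Sparse vectors and the Euclidean norm -/

lemma l2norm_nonneg {n : ℕ} (x : Fin n → ℝ) : 0 ≤ l2norm x := norm_nonneg _

lemma l2norm_sq {n : ℕ} (x : Fin n → ℝ) : l2norm x ^ 2 = ∑ i, x i ^ 2 :=
  EuclideanSpace.real_norm_sq_eq _

lemma l2norm_eq_zero_iff {n : ℕ} {x : Fin n → ℝ} : l2norm x = 0 ↔ x = 0 := by
  rw [l2norm, norm_eq_zero, WithLp.toLp_eq_zero]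

lemma isSparse_of_forall_ne {N s : ℕ} {f : Fin N → ℝ} (T : Finset (Fin N)) (hT : T.card ≤ s)
    (hf : ∀ j, f j ≠ 0 → j ∈ T) : IsSparse s f := by
  have h : Function.support f ⊆ (T : Set (Fin N)) := fun j hj => hf j hj
  have := Set.ncard_le_ncard h T.finite_toSet
  rw [Set.ncard_coe_finset] at this
  exact this.trans hT

/-- The indicator vector of a set of coordinates. -/
noncomputable def indicatorVec {N : ℕ} (T : Finset (Fin N)) : Fin N → ℝ :=
  fun j => if j ∈ T then 1 else 0

lemma l2norm_indicatorVec_sq {N : ℕ} (T : Finset (Fin N)) :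
    l2norm (indicatorVec T) ^ 2 = T.card := by
  simp [l2norm_sq, indicatorVec]

lemma isSparse_indicatorVec {N s : ℕ} (T : Finset (Fin N)) (hT : T.card ≤ s) :
    IsSparse s (indicatorVec T) :=
  isSparse_of_forall_ne T hT fun j hj => by
    by_contra h
    simp [indicatorVec, h] at hj

lemma isSparse_indicatorVec_sub {N s : ℕ} (T T' : Finset (Fin N)) (hT : T.card ≤ s)
    (hT' : T'.card ≤ s) : IsSparse (2 * s) (indicatorVec T - indicatorVec T') := by
  classical
  refine isSparse_of_forall_ne (T ∪ T') ((Finset.card_union_le _ _).trans (by omega)) fun j hj => ?_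
  by_contra h
  rw [Finset.mem_union, not_or] at h
  simp [indicatorVec, h.1, h.2] at hj

/-! ### The restricted isometry properties -/

lemma HasRIP.mono {m N s : ℕ} {Φ : Matrix (Fin m) (Fin N) ℝ} {D D' : ℝ} (h : HasRIP Φ s D)
    (hD : D ≤ D') : HasRIP Φ s D' := by
  obtain ⟨c, hc, h⟩ := h
  refine ⟨c, hc, fun f hf => ⟨(h f hf).1, (h f hf).2.trans ?_⟩⟩
  have := l2norm_nonneg (Φ *ᵥ f)
  gcongr

/-- Boundedness of the linear map `Φ` makes the infimum in the definition of `ric` one over a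
non-empty set, so that a bound on `ric` does give the two-sided estimate. -/
lemma exists_isometry_const_lt_of_ric_lt {m N s : ℕ} {Φ : Matrix (Fin m) (Fin N) ℝ} {δ : ℝ}
    (h : ric Φ s < δ) : ∃ δ' : ℝ, 0 ≤ δ' ∧ δ' < δ ∧ ∀ f : Fin N → ℝ, IsSparse s f →
      (1 - δ') * l2norm f ^ 2 ≤ l2norm (Φ *ᵥ f) ^ 2 ∧
        l2norm (Φ *ᵥ f) ^ 2 ≤ (1 + δ') * l2norm f ^ 2 := by
  have hne : {δ : ℝ | 0 ≤ δ ∧ ∀ f : Fin N → ℝ, IsSparse s f →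
      (1 - δ) * l2norm f ^ 2 ≤ l2norm (Φ *ᵥ f) ^ 2 ∧
        l2norm (Φ *ᵥ f) ^ 2 ≤ (1 + δ) * l2norm f ^ 2}.Nonempty := by
    let L := (Matrix.toLpLin 2 2 Φ).toContinuousLinearMap
    refine ⟨1 + ‖L‖ ^ 2, by positivity, fun f _ => ?_⟩
    have hL : l2norm (Φ *ᵥ f) ≤ ‖L‖ * l2norm f := L.le_opNorm (WithLp.toLp 2 f)
    have h2 : l2norm (Φ *ᵥ f) ^ 2 ≤ (‖L‖ * l2norm f) ^ 2 :=
      pow_le_pow_left₀ (l2norm_nonneg _) hL 2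
    constructor
    · nlinarith [sq_nonneg (l2norm (Φ *ᵥ f)), sq_nonneg (‖L‖ * l2norm f)]
    · nlinarith [sq_nonneg (l2norm f)]
  obtain ⟨δ', hδ', hlt⟩ := exists_lt_of_csInf_lt hne h
  exact ⟨δ', hδ'.1, hlt, hδ'.2⟩

lemma hasRIP_of_ric_lt {m N s : ℕ} {Φ : Matrix (Fin m) (Fin N) ℝ} {δ : ℝ} (hδ : δ < 1)
    (h : ric Φ s < δ) : HasRIP Φ s √((1 + δ) / (1 - δ)) := by
  obtain ⟨δ', h0, hlt, h⟩ := exists_isometry_const_lt_of_ric_lt h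
  have h1 : 0 < 1 - δ := by linarith
  have h2 : 0 < 1 + δ := by linarith
  refine ⟨1 / √(1 + δ), by positivity, fun f hf => ?_⟩
  obtain ⟨hl, hu⟩ := h f hf
  have hf0 := l2norm_nonneg f
  have hF0 := l2norm_nonneg (Φ *ᵥ f)
  constructor
  · rw [one_div, inv_mul_le_iff₀ (by positivity)]
    refine Real.le_sqrt_of_sq_le ?_ |>.trans_eq ?_ (b := √((1 + δ) * l2norm f ^ 2))
    · nlinarith [sq_nonneg (l2norm f)]
    · rw [Real.sqrt_mul h2.le, Real.sqrt_sq hf0]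
  · have : 1 / √(1 + δ) * √((1 + δ) / (1 - δ)) = 1 / √(1 - δ) := by
      rw [Real.sqrt_div h2.le]
      field_simp
    rw [this, one_div, ← div_eq_inv_mul, le_div_iff₀ (by positivity)]
    refine abs_le_of_sq_le_sq' ?_ hF0 |>.2
    rw [mul_pow, Real.sq_sqrt h1.le]
    nlinarith [sq_nonneg (l2norm f)]

/-- A matrix with the restricted isometry property of order `s` is injective on any `s`
coordinates. -/
lemma HasRIP.sparsity_le {m N s : ℕ} {Φ : Matrix (Fin m) (Fin N) ℝ} {D : ℝ} (h : HasRIP Φ s D)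
    (hs : s ≤ N) : s ≤ m := by
  obtain ⟨c, hc, h⟩ := h
  let e : Fin s → Fin N := Fin.castLE hs
  have he : Function.Injective e := Fin.castLE_injective hs
  let A := Function.ExtendByZero.linearMap ℝ e
  have hA : Function.Injective (Matrix.mulVecLin Φ ∘ₗ A) := by
    rw [injective_iff_map_eq_zero]
    intro x hx
    have hΦ : Φ *ᵥ (A x) = 0 := hx
    have hsp : IsSparse s (A x) := by
      classical
      refine isSparse_of_forall_ne (Finset.univ.image e)
        (Finset.card_image_le.trans (by simp)) fun j hj => ?_
      by_contra hj'
      refine hj (Function.extend_apply' _ _ _ ?_)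
      simpa using hj'
    have h0 := (h _ hsp).2
    rw [hΦ, l2norm_eq_zero_iff.2 rfl, mul_zero] at h0
    have hz : A x = 0 := l2norm_eq_zero_iff.1 (le_antisymm h0 (l2norm_nonneg _))
    funext i
    have := congrFun hz (e i)
    rwa [show A x (e i) = x i from he.extend_apply _ _ _] at this
  simpa using LinearMap.finrank_le_finrank_of_injective hA

/-! ### Separated points in a ball -/

/-- Disjoint balls of radius `ε / 2` around the points lie in the ball of radius `R + ε / 2`;
compare volumes. -/
lemma card_le_of_norm_le_of_separated {E ι : Type*} [NormedAddCommGroup E] [NormedSpace ℝ E]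
    [FiniteDimensional ℝ E] {R ε : ℝ} (hR : 0 ≤ R) (hε : 0 < ε) (C : Finset ι) (x : ι → E)
    (hx : ∀ a ∈ C, ‖x a‖ ≤ R) (h : ∀ a ∈ C, ∀ b ∈ C, a ≠ b → ε ≤ ‖x a - x b‖) :
    (C.card : ℝ) ≤ (1 + 2 * (R / ε)) ^ Module.finrank ℝ E := by
  borelize E
  let μ : Measure E := Measure.addHaar
  have hε2 : 0 < ε / 2 := by positivity
  have hρ : 0 < R + ε / 2 := by positivity
  have hdisj : Set.Pairwise (C : Set ι)
      (Function.onFun Disjoint fun a => Metric.ball (x a) (ε / 2)) := by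
    intro a ha b hb hab
    apply Metric.ball_disjoint_ball
    rw [dist_eq_norm, add_halves]
    exact h a ha b hb hab
  have hsub : (⋃ a ∈ C, Metric.ball (x a) (ε / 2)) ⊆ Metric.ball 0 (R + ε / 2) := by
    refine Set.iUnion₂_subset fun a ha => Metric.ball_subset_ball' ?_
    rw [dist_zero_right, add_comm]
    linarith [hx a ha]
  have hvol : (C.card : ENNReal) * ENNReal.ofReal ((ε / 2) ^ Module.finrank ℝ E) *
      μ (Metric.ball 0 1) ≤
        ENNReal.ofReal ((R + ε / 2) ^ Module.finrank ℝ E) * μ (Metric.ball 0 1) := by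
    have := measure_mono (μ := μ) hsub
    rw [measure_biUnion_finset hdisj fun a _ => measurableSet_ball] at this
    simpa only [μ.addHaar_ball_of_pos _ hε2, μ.addHaar_ball_of_pos _ hρ, Finset.sum_const,
      nsmul_eq_mul, mul_assoc] using this
  have hcard := (ENNReal.mul_le_mul_iff_left
    (Metric.measure_ball_pos _ _ zero_lt_one).ne' measure_ball_lt_top.ne).1 hvol
  have hreal := ENNReal.toReal_le_of_le_ofReal (pow_nonneg hρ.le _) hcard
  rw [ENNReal.toReal_mul, ENNReal.toReal_natCast, ENNReal.toReal_ofReal (by positivity)] at hreal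
  have : 1 + 2 * (R / ε) = (R + ε / 2) / (ε / 2) := by field_simp; ring
  rwa [this, div_pow, le_div_iff₀ (by positivity)]

/-! ### A Gilbert–Varshamov code -/

/-- Greedy packing: a maximal family of pairwise unrelated elements has all elements of the type
in its neighbourhoods. -/
lemma exists_pairwise_not_rel_card_le {α : Type*} [Fintype α] (r : α → α → Prop)
    [∀ a, DecidablePred (r a)] (hsymm : ∀ a b, r a b → r b a) (hrefl : ∀ a, r a a) (M : ℕ)
    (hM : ∀ a, (Finset.univ.filter (r a)).card ≤ M) :
    ∃ C : Finset α, (∀ a ∈ C, ∀ b ∈ C, a ≠ b → ¬ r a b) ∧ Fintype.card α ≤ C.card * M := by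
  classical
  obtain ⟨C, hC, hmax⟩ := Finset.exists_max_image
    (Finset.univ.filter fun C : Finset α => ∀ a ∈ C, ∀ b ∈ C, a ≠ b → ¬ r a b) Finset.card
    ⟨∅, by simp⟩
  simp only [Finset.mem_filter, Finset.mem_univ, true_and] at hC hmax
  refine ⟨C, hC, ?_⟩
  have hcover : Finset.univ ⊆ C.biUnion fun a => Finset.univ.filter (r a) := by
    intro b _
    by_contra hb
    simp only [Finset.mem_biUnion, Finset.mem_filter, Finset.mem_univ, true_and, not_exists,
      not_and] at hb
    have hbC : b ∉ C := fun hbC => hb b hbC (hrefl b)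
    have := hmax (insert b C) (by
      intro a ha a' ha' hne
      rw [Finset.mem_insert] at ha ha'
      rcases ha with rfl | ha <;> rcases ha' with rfl | ha'
      · exact absurd rfl hne
      · exact fun h => hb a' ha' (hsymm _ _ h)
      · exact hb a ha
      · exact hC a ha a' ha' hne)
    rw [Finset.card_insert_of_notMem hbC] at this
    omega
  exact (Finset.card_le_card hcover).trans (Finset.card_biUnion_le_card_mul _ _ _ fun a _ => hM a)

/-- The words agreeing with `w` in more than half of the places: choose the set of agreement, then
the remaining letters. -/
lemma card_filter_agree_le (s q : ℕ) (w : Fin s → Fin q) :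
    (Finset.univ.filter fun w' : Fin s → Fin q =>
      s < 2 * (Finset.univ.filter fun i => w i = w' i).card).card ≤ 2 ^ s * q ^ (s / 2) := by
  classical
  rcases Nat.eq_zero_or_pos s with rfl | hs
  · simp
  have hq : 1 ≤ q := (Fin.pos (w ⟨0, hs⟩))
  let B : Finset (Fin s) → Finset (Fin s → Fin q) := fun A =>
    Fintype.piFinset fun i => if i ∈ A then {w i} else Finset.univ
  have hsub : (Finset.univ.filter fun w' : Fin s → Fin q =>
      s < 2 * (Finset.univ.filter fun i => w i = w' i).card) ⊆
        (Finset.univ.filter fun A : Finset (Fin s) => s < 2 * A.card).biUnion B := by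
    intro w' hw'
    rw [Finset.mem_filter] at hw'
    rw [Finset.mem_biUnion]
    refine ⟨Finset.univ.filter fun i => w i = w' i, by simpa using hw'.2, ?_⟩
    rw [Fintype.mem_piFinset]
    intro i
    by_cases hi : w i = w' i <;> simp [hi]
  refine (Finset.card_le_card hsub).trans ((Finset.card_biUnion_le_card_mul _ _ (q ^ (s / 2))
    fun A hA => ?_).trans (Nat.mul_le_mul_right _ ?_))
  · rw [Finset.mem_filter] at hA
    have : (B A).card = q ^ (Finset.univ.filter fun i => i ∉ A).card := by
      rw [Fintype.card_piFinset, ← Finset.prod_const, Finset.prod_filter]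
      refine Finset.prod_congr rfl fun i _ => ?_
      by_cases hi : i ∈ A <;> simp [hi]
    rw [this]
    refine Nat.pow_le_pow_right hq ?_
    have h1 : (Finset.univ.filter fun i => i ∉ A) = Aᶜ := by ext; simp
    rw [h1, Finset.card_compl, Fintype.card_fin]
    omega
  · refine (Finset.card_filter_le _ _).trans ?_
    simp

/-- A Gilbert–Varshamov code with words of length `s` over `q` letters, any two of which differ in
at least half of the places. -/
lemma exists_code (s q : ℕ) (hq : 0 < q) : ∃ C : Finset (Fin s → Fin q),
    (∀ w ∈ C, ∀ w' ∈ C, w ≠ w' → s ≤ 2 * (Finset.univ.filter fun i => w i ≠ w' i).card) ∧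
      q ^ s ≤ C.card ^ 2 * 4 ^ s := by
  classical
  rcases Nat.eq_zero_or_pos s with rfl | hs
  · exact ⟨Finset.univ, by simp⟩
  obtain ⟨C, hC, hcard⟩ := exists_pairwise_not_rel_card_le
    (fun w w' : Fin s → Fin q => s < 2 * (Finset.univ.filter fun i => w i = w' i).card)
    (fun w w' h => by simpa only [eq_comm] using h)
    (fun w => by simp; omega) _ (card_filter_agree_le s q)
  refine ⟨C, fun w hw w' hw' hne => ?_, ?_⟩
  · have h1 := hC w hw w' hw' hne
    have h2 := Finset.card_filter_add_card_filter_not (s := Finset.univ) (fun i => w i = w' i)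
    simp only [Finset.card_univ, Fintype.card_fin] at h2
    simp only [ne_eq]
    omega
  · rw [Fintype.card_fun, Fintype.card_fin, Fintype.card_fin] at hcard
    have h1 : (q ^ s) ^ 2 ≤ (C.card * (2 ^ s * q ^ (s / 2))) ^ 2 := Nat.pow_le_pow_left hcard 2
    have h2 : (q ^ (s / 2)) ^ 2 ≤ q ^ s := by
      rw [← pow_mul]
      exact Nat.pow_le_pow_right hq (by omega)
    have h3 : (4 : ℕ) ^ s = (2 ^ s) ^ 2 := by
      rw [← pow_mul, mul_comm, pow_mul]
      norm_num
    refine Nat.le_of_mul_le_mul_right (c := q ^ s) ?_ (by positivity)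
    calc q ^ s * q ^ s = (q ^ s) ^ 2 := by ring
      _ ≤ C.card ^ 2 * (2 ^ s) ^ 2 * (q ^ (s / 2)) ^ 2 := h1.trans_eq (by ring)
      _ ≤ C.card ^ 2 * 4 ^ s * q ^ s := by rw [h3]; gcongr

/-! ### The lower bound for general matrices -/

/-- The code words are turned into indicator vectors of `s`-sets, with one coordinate in each of
`s` disjoint blocks of `q` coordinates; their images under `Φ` are separated points in a ball. -/
lemma HasRIP.pow_le {m N s q : ℕ} {Φ : Matrix (Fin m) (Fin N) ℝ} {D : ℝ} (hD : 1 ≤ D)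
    (h : HasRIP Φ (2 * s) D) (hs : 0 < s) (hq : 0 < q) (hqN : s * q ≤ N) :
    (q : ℝ) ^ s ≤ ((1 + 3 * D) ^ m) ^ 2 * 4 ^ s := by
  classical
  obtain ⟨C, hC, hcard⟩ := exists_code s q hq
  obtain ⟨c, hc, h⟩ := h
  obtain ⟨e⟩ : Nonempty (Fin s × Fin q ↪ Fin N) :=
    Function.Embedding.nonempty_of_card_le (by simpa using hqN)
  let T : (Fin s → Fin q) → Finset (Fin N) := fun w => Finset.univ.image fun i => e (i, w i)
  have hT : ∀ w, (T w).card ≤ s := fun w => Finset.card_image_le.trans (by simp)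
  have hmem : ∀ (w w' : Fin s → Fin q) (i : Fin s), e (i, w i) ∈ T w' ↔ w' i = w i := by
    intro w w' i
    simp only [T, Finset.mem_image, Finset.mem_univ, true_and, EmbeddingLike.apply_eq_iff_eq,
      Prod.mk.injEq]
    exact ⟨fun ⟨a, ha, hw⟩ => ha ▸ hw, fun hw => ⟨i, rfl, hw⟩⟩
  have hsep : ∀ w ∈ C, ∀ w' ∈ C, w ≠ w' →
      √(s / 2) ≤ l2norm (indicatorVec (T w) - indicatorVec (T w')) := by
    intro w hw w' hw' hne
    refine (Real.sqrt_le_left (l2norm_nonneg _)).2 ?_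
    have hinj : Function.Injective fun i => e (i, w i) := fun i j hij => by
      simpa using congrArg Prod.fst (e.injective hij)
    -- only the coordinates chosen by `w` at the places where `w'` differs are counted
    calc (s / 2 : ℝ) ≤ (Finset.univ.filter fun i => w i ≠ w' i).card := by
          have : (s : ℝ) ≤ 2 * ((Finset.univ.filter fun i => w i ≠ w' i).card : ℝ) := by
            exact_mod_cast hC w hw w' hw' hne
          linarith
      _ = ∑ i, (indicatorVec (T w) - indicatorVec (T w')) (e (i, w i)) ^ 2 := by
          rw [Finset.card_filter, Nat.cast_sum]
          refine Finset.sum_congr rfl fun i _ => ?_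
          by_cases hi : w i = w' i
          · simp [indicatorVec, hmem, hi]
          · simp [indicatorVec, hmem, hi, Ne.symm hi]
      _ = ∑ j ∈ T w, (indicatorVec (T w) - indicatorVec (T w')) j ^ 2 := by
          rw [Finset.sum_image fun i _ j _ hij => hinj hij]
      _ ≤ _ := by
          rw [l2norm_sq]
          exact Finset.sum_le_sum_of_subset_of_nonneg (Finset.subset_univ _)
            fun _ _ _ => sq_nonneg _
  have hs' : (0 : ℝ) < s := by exact_mod_cast hs
  have hbound := card_le_of_norm_le_of_separated (E := EuclideanSpace ℝ (Fin m))
    (R := √s / c) (ε := √(s / 2) / (c * D)) (by positivity) (by positivity) C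
    (fun w => WithLp.toLp 2 (Φ *ᵥ indicatorVec (T w))) (fun w hw => ?_) (fun w hw w' hw' hne => ?_)
  · have hratio : √s / c / (√(s / 2) / (c * D)) = √2 * D := by
      rw [Real.sqrt_div hs'.le]
      field_simp
    have hsqrt : 2 * √2 ≤ 3 := by
      nlinarith [Real.sq_sqrt (show (0 : ℝ) ≤ 2 by norm_num), Real.sqrt_nonneg 2]
    rw [hratio, finrank_euclideanSpace_fin] at hbound
    have hle : (C.card : ℝ) ≤ (1 + 3 * D) ^ m := by
      refine hbound.trans (pow_le_pow_left₀ (by positivity) ?_ m)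
      nlinarith
    calc (q : ℝ) ^ s ≤ (C.card : ℝ) ^ 2 * 4 ^ s := by exact_mod_cast hcard
      _ ≤ _ := by gcongr
  · rw [le_div_iff₀ hc, mul_comm]
    refine (h _ (isSparse_indicatorVec (s := 2 * s) _ ((hT w).trans (by omega)))).1.trans ?_
    refine Real.le_sqrt_of_sq_le ?_
    rw [l2norm_indicatorVec_sq]
    exact_mod_cast hT w
  · rw [div_le_iff₀ (by positivity), mul_comm, ← WithLp.toLp_sub, ← Matrix.mulVec_sub]
    exact (hsep w hw w' hw' hne).trans
      (h _ (isSparse_indicatorVec_sub _ _ (hT w) (hT w'))).2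

/-- The lower bound on the number of rows that the restricted isometry property forces on any
matrix. The packing bound is useful once `N / s` exceeds an absolute constant; below it, the
injectivity bound `s ≤ m` suffices. -/
lemma HasRIP.mul_log_le {m N s : ℕ} {Φ : Matrix (Fin m) (Fin N) ℝ} {D : ℝ} (hD : 1 ≤ D)
    (h : HasRIP Φ (2 * s) D) :
    min (1 / 5) (1 / (4 * Real.log (1 + 3 * D))) * ((s : ℝ) * Real.log ((N : ℝ) / (s : ℝ))) ≤
      (m : ℝ) := by
  have hlogD : 0 < Real.log (1 + 3 * D) := Real.log_pos (by linarith)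
  rcases Nat.eq_zero_or_pos s with rfl | hs
  · simp
  have hs' : (0 : ℝ) < s := by exact_mod_cast hs
  rcases lt_or_ge N s with hNs | hNs
  · have : Real.log ((N : ℝ) / s) ≤ 0 := by
      refine Real.log_nonpos (by positivity) ?_
      rw [div_le_one hs']
      exact_mod_cast hNs.le
    refine (mul_nonpos_of_nonneg_of_nonpos (by positivity) ?_).trans (Nat.cast_nonneg m)
    exact mul_nonpos_of_nonneg_of_nonpos hs'.le this
  have hN1 : 1 ≤ (N : ℝ) / s := by
    rw [one_le_div hs']
    exact_mod_cast hNs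
  have hlog0 : 0 ≤ Real.log ((N : ℝ) / s) := Real.log_nonneg hN1
  have hx0 : 0 ≤ (s : ℝ) * Real.log ((N : ℝ) / s) := by positivity
  rcases lt_or_ge N (64 * s) with hsmall | hlarge
  · have hsm : (s : ℝ) ≤ m := by
      have hsp : HasRIP Φ s D := by
        obtain ⟨c, hc, h⟩ := h
        exact ⟨c, hc, fun f hf => h f (le_trans hf (by omega))⟩
      exact_mod_cast hsp.sparsity_le hNs
    have hlog : Real.log ((N : ℝ) / s) ≤ 5 := by
      have h64 : (N : ℝ) / s ≤ 2 ^ 6 := by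
        rw [div_le_iff₀ hs']
        have : (N : ℝ) < 64 * s := by exact_mod_cast hsmall
        linarith
      refine (Real.log_le_log (by linarith) h64).trans ?_
      rw [Real.log_pow]
      have := Real.log_two_lt_d9
      norm_num
      linarith
    calc _ ≤ 1 / 5 * ((s : ℝ) * Real.log ((N : ℝ) / s)) :=
          mul_le_mul_of_nonneg_right (min_le_left _ _) hx0
      _ ≤ m := by nlinarith
  · have hq : 0 < N / s := Nat.div_pos hNs hs
    have hpow := h.pow_le hD hs hq (Nat.mul_div_le N s)
    have hqN : (N : ℝ) / s ≤ 2 * ((N / s : ℕ) : ℝ) := by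
      rw [div_le_iff₀ hs']
      have h1 := Nat.lt_div_mul_add (a := N) hs
      have h2 : s ≤ N / s * s := Nat.le_mul_of_pos_left s hq
      have : N ≤ 2 * (N / s) * s := by nlinarith
      exact_mod_cast this
    have hN64 : 64 ≤ (N : ℝ) / s := by
      rw [le_div_iff₀ hs']
      exact_mod_cast hlarge
    -- `q = ⌊N / s⌋` satisfies `q ≥ N / (2 s) ≥ 4 √(N / s)`
    have hlogq : Real.log ((N : ℝ) / s) ≤ 2 * Real.log (((N / s : ℕ) : ℝ) / 4) := by
      rw [← Nat.cast_two (R := ℝ), ← Real.log_pow]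
      refine Real.log_le_log (by linarith) ?_
      nlinarith
    have hpow' : (((N / s : ℕ) : ℝ) / 4) ^ s ≤ (1 + 3 * D) ^ (m * 2) := by
      rw [div_pow, div_le_iff₀ (by positivity), pow_mul]
      exact hpow
    have hqpos : (0 : ℝ) < ((N / s : ℕ) : ℝ) / 4 := by
      have : (0 : ℝ) < ((N / s : ℕ) : ℝ) := by exact_mod_cast hq
      positivity
    have hlogs := Real.log_le_log (by positivity) hpow'
    rw [Real.log_pow, Real.log_pow] at hlogs
    push_cast at hlogs
    calc _ ≤ 1 / (4 * Real.log (1 + 3 * D)) * ((s : ℝ) * Real.log ((N : ℝ) / s)) :=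
          mul_le_mul_of_nonneg_right (min_le_right _ _) hx0
      _ ≤ m := by
          rw [one_div, inv_mul_le_iff₀ (by positivity)]
          nlinarith

/-! ### The lower bound for Count-Min type matrices -/

lemma IsCountMinMatrix.sum_column {m N k : ℕ} {Φ : Matrix (Fin m) (Fin N) ℝ}
    (hΦ : IsCountMinMatrix Φ k) (j : Fin N) : ∑ i, Φ i j = k := by
  classical
  have h1 : ∀ i, Φ i j = if Φ i j = 1 then 1 else 0 := fun i => by
    rcases hΦ.zero_or_one i j with h | h <;> simp [h]
  rw [Finset.sum_congr rfl fun i _ => h1 i, Finset.sum_boole, ← hΦ.ones_in_column j,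
    Set.ncard_eq_toFinset_card']
  simp

lemma IsCountMinMatrix.sum_columns {m N k : ℕ} {Φ : Matrix (Fin m) (Fin N) ℝ}
    (hΦ : IsCountMinMatrix Φ k) (T : Finset (Fin N)) : ∑ i, ∑ j ∈ T, Φ i j = k * T.card := by
  refine Finset.sum_comm.trans ?_
  simp [hΦ.sum_column, mul_comm]

lemma IsCountMinMatrix.sq_entry {m N k : ℕ} {Φ : Matrix (Fin m) (Fin N) ℝ}
    (hΦ : IsCountMinMatrix Φ k) (i : Fin m) (j : Fin N) : Φ i j ^ 2 = Φ i j := by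
  rcases hΦ.zero_or_one i j with h | h <;> simp [h]

lemma mulVec_indicatorVec {m N : ℕ} (Φ : Matrix (Fin m) (Fin N) ℝ) (T : Finset (Fin N))
    (i : Fin m) : (Φ *ᵥ indicatorVec T) i = ∑ j ∈ T, Φ i j := by
  classical
  simp [Matrix.mulVec, dotProduct, indicatorVec]

/-- Testing the restricted isometry property on a unit vector determines the scale `c` up to the
distortion; on indicator vectors of small sets it then bounds `Φ` from above. -/
lemma HasRIP.sq_l2norm_mulVec_indicatorVec_le {m N s k : ℕ} {Φ : Matrix (Fin m) (Fin N) ℝ} {D : ℝ}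
    (h : HasRIP Φ s D) (hΦ : IsCountMinMatrix Φ k) (hs : 0 < s) (hN : 0 < N) :
    0 < D ∧ 0 < k ∧ ∀ T : Finset (Fin N), T.card ≤ s →
      l2norm (Φ *ᵥ indicatorVec T) ^ 2 ≤ D ^ 2 * k * T.card := by
  obtain ⟨c, hc, h⟩ := h
  let j₀ : Fin N := ⟨0, hN⟩
  have hk : l2norm (Φ *ᵥ indicatorVec {j₀}) ^ 2 = k := by
    simp only [l2norm_sq, mulVec_indicatorVec, Finset.sum_singleton, hΦ.sq_entry]
    exact hΦ.sum_column j₀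
  have h1 : l2norm (indicatorVec {j₀}) = 1 := by
    have := l2norm_indicatorVec_sq {j₀}
    rw [Finset.card_singleton, Nat.cast_one] at this
    nlinarith [l2norm_nonneg (indicatorVec {j₀})]
  have hb := (h _ (isSparse_indicatorVec {j₀} (by rwa [Finset.card_singleton]))).2
  rw [h1] at hb
  have hy := l2norm_nonneg (Φ *ᵥ indicatorVec {j₀})
  have hD : 0 < D := by
    by_contra hD
    have : c * D ≤ 0 := mul_nonpos_of_nonneg_of_nonpos hc.le (not_lt.1 hD)
    nlinarith
  have hypos : 0 < l2norm (Φ *ᵥ indicatorVec {j₀}) := by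
    rcases hy.lt_or_eq with hy | hy
    · exact hy
    · rw [← hy] at hb
      linarith
  have hkpos : (0 : ℝ) < k := hk ▸ by positivity
  refine ⟨hD, by exact_mod_cast hkpos, fun T hT => ?_⟩
  have hc2 : 1 ≤ c ^ 2 * (D ^ 2 * k) := by
    rw [← hk]
    calc (1 : ℝ) ≤ (c * D * l2norm (Φ *ᵥ indicatorVec {j₀})) ^ 2 := one_le_pow₀ hb
      _ = _ := by ring
  have hu := pow_le_pow_left₀ (mul_nonneg hc.le (l2norm_nonneg _))
    (h _ (isSparse_indicatorVec T hT)).1 2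
  rw [l2norm_indicatorVec_sq, mul_pow] at hu
  have hDk : 0 < D ^ 2 * k := by positivity
  calc l2norm (Φ *ᵥ indicatorVec T) ^ 2
      ≤ (c ^ 2 * (D ^ 2 * k)) * l2norm (Φ *ᵥ indicatorVec T) ^ 2 :=
        le_mul_of_one_le_left (sq_nonneg _) hc2
    _ = (D ^ 2 * k) * (c ^ 2 * l2norm (Φ *ᵥ indicatorVec T) ^ 2) := by ring
    _ ≤ _ := mul_le_mul_of_nonneg_left hu hDk.le

/-- The `k t` ones in `t` columns spread over `m` rows, so that by Cauchy–Schwarz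
`‖Φ 1_T‖² ≥ (k t)² / m`. -/
lemma IsCountMinMatrix.sq_le_mul_sq_l2norm {m N k : ℕ} {Φ : Matrix (Fin m) (Fin N) ℝ}
    (hΦ : IsCountMinMatrix Φ k) (T : Finset (Fin N)) :
    ((k : ℝ) * T.card) ^ 2 ≤ m * l2norm (Φ *ᵥ indicatorVec T) ^ 2 := by
  have hsum : ∑ i, (Φ *ᵥ indicatorVec T) i = k * T.card := by
    simp only [mulVec_indicatorVec]
    exact hΦ.sum_columns T
  rw [← hsum, l2norm_sq]
  simpa using sq_sum_le_card_mul_sum_sq (s := Finset.univ) (f := Φ *ᵥ indicatorVec T)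

/-- Any `t` ones in a single row give `‖Φ 1_T‖² ≥ t²` for the set `T` of their columns; hence a row
has fewer than `s` ones as soon as `B < s`, and then in fact at most `B`. -/
lemma IsCountMinMatrix.sum_row_le {m N s k : ℕ} {Φ : Matrix (Fin m) (Fin N) ℝ} {B : ℝ}
    (hΦ : IsCountMinMatrix Φ k) (hB : 0 ≤ B) (hBs : B < s)
    (h : ∀ T : Finset (Fin N), T.card ≤ s → l2norm (Φ *ᵥ indicatorVec T) ^ 2 ≤ B * T.card)
    (i : Fin m) : ∑ j, Φ i j ≤ B := by
  classical
  let S : Finset (Fin N) := Finset.univ.filter fun j => Φ i j = 1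
  have hS : ∑ j, Φ i j = S.card := by
    have h1 : ∀ j, Φ i j = if Φ i j = 1 then 1 else 0 := fun j => by
      rcases hΦ.zero_or_one i j with h | h <;> simp [h]
    rw [Finset.sum_congr rfl fun j _ => h1 j, Finset.sum_boole]
  obtain ⟨T, hTS, hT⟩ := Finset.exists_subset_card_eq (min_le_left S.card s)
  have hrow : (Φ *ᵥ indicatorVec T) i = T.card := by
    rw [mulVec_indicatorVec, Finset.sum_congr rfl fun j hj => (Finset.mem_filter.1 (hTS hj)).2]
    simp
  have hsq : (T.card : ℝ) ^ 2 ≤ B * T.card := by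
    refine le_trans ?_ (h T (hT ▸ min_le_right _ _))
    rw [l2norm_sq, ← hrow]
    exact Finset.single_le_sum (f := fun i => (Φ *ᵥ indicatorVec T) i ^ 2)
      (fun _ _ => sq_nonneg _) (Finset.mem_univ i)
  have hTB : (T.card : ℝ) ≤ B := by
    rcases Nat.eq_zero_or_pos T.card with h0 | h0
    · simpa [h0] using hB
    · have : (0 : ℝ) < T.card := by exact_mod_cast h0
      nlinarith
  have hTs : T.card < s := by exact_mod_cast hTB.trans_lt hBs
  have : T.card = S.card := by omega
  rwa [hS, ← this]

lemma IsCountMinMatrix.min_le {m N s k : ℕ} {Φ : Matrix (Fin m) (Fin N) ℝ} {D : ℝ}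
    (hΦ : IsCountMinMatrix Φ k) (h : HasRIP Φ s D) :
    min ((s : ℝ) ^ 2 / D ^ 4) ((N : ℝ) / D ^ 2) ≤ (m : ℝ) := by
  rcases Nat.eq_zero_or_pos s with rfl | hs
  · exact (min_le_left _ _).trans (by simp)
  rcases Nat.eq_zero_or_pos N with rfl | hN
  · exact (min_le_right _ _).trans (by simp)
  obtain ⟨hD, hk, hup⟩ := h.sq_l2norm_mulVec_indicatorVec_le hΦ hs hN
  have hk1 : (1 : ℝ) ≤ k := by exact_mod_cast hk
  have hcols : ∀ t : ℕ, 0 < t → t ≤ s → t ≤ N → (k : ℝ) * t ≤ m * D ^ 2 := by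
    intro t ht hts htN
    obtain ⟨T, -, hT⟩ := Finset.exists_subset_card_eq
      (s := (Finset.univ : Finset (Fin N))) (n := t) (by simpa using htN)
    have h1 := hΦ.sq_le_mul_sq_l2norm T
    have h2 := mul_le_mul_of_nonneg_left (hup T (hT ▸ hts)) (Nat.cast_nonneg (α := ℝ) m)
    rw [hT] at h1 h2
    have ht' : (0 : ℝ) < t := by exact_mod_cast ht
    have hkt : (0 : ℝ) < k * t := by positivity
    nlinarith [h1.trans h2]
  rcases le_or_gt N s with hNs | hNs
  · refine (min_le_right _ _).trans ?_
    rw [div_le_iff₀ (by positivity)]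
    have := hcols N hN hNs le_rfl
    have hN' : (0 : ℝ) ≤ N := Nat.cast_nonneg N
    nlinarith
  rcases le_or_gt (s : ℝ) (D ^ 2 * k) with hsk | hsk
  · refine (min_le_left _ _).trans ?_
    rw [div_le_iff₀ (by positivity)]
    have := hcols s hs le_rfl hNs.le
    have hs' : (0 : ℝ) ≤ s := Nat.cast_nonneg s
    have hD2 : 0 < D ^ 2 := by positivity
    calc (s : ℝ) ^ 2 ≤ D ^ 2 * k * s := by nlinarith
      _ = D ^ 2 * (k * s) := by ring
      _ ≤ D ^ 2 * (m * D ^ 2) := by gcongr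
      _ = m * D ^ 4 := by ring
  · refine (min_le_right _ _).trans ?_
    rw [div_le_iff₀ (by positivity)]
    have hrows := Finset.sum_le_sum fun i (_ : i ∈ (Finset.univ : Finset (Fin m))) =>
      hΦ.sum_row_le (by positivity) hsk hup i
    rw [hΦ.sum_columns] at hrows
    simp only [Finset.sum_const, Finset.card_univ, Fintype.card_fin, nsmul_eq_mul] at hrows
    have hk0 : (0 : ℝ) < k := by linarith
    refine le_of_mul_le_mul_right ?_ hk0
    linarith

/-! ### The three lower bounds -/

theorem mainTheorem1 :
    -- Gaussian matrices, restricted isometry constant of order `2s` bounded away from `1`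
    (∀ δ : ℝ, 0 ≤ δ → δ < 1 → ∃ C : ℝ, 0 < C ∧
      ∀ (Ω : Type*) [MeasurableSpace Ω] (P : Measure Ω) [IsProbabilityMeasure P]
        (m N s : ℕ) (v : ℝ≥0) (Φ : Ω → Matrix (Fin m) (Fin N) ℝ),
        IsGaussianMatrix P Φ v → 0 < P {ω | ric (Φ ω) (2 * s) ≤ δ} →
          C * ((s : ℝ) * Real.log ((N : ℝ) / (s : ℝ))) ≤ (m : ℝ)) ∧
    -- Gaussian matrices, scale-invariant restricted isometry property of order `2s`
    (∀ D : ℝ, ∃ C : ℝ, 0 < C ∧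
      ∀ (Ω : Type*) [MeasurableSpace Ω] (P : Measure Ω) [IsProbabilityMeasure P]
        (m N s : ℕ) (v : ℝ≥0) (Φ : Ω → Matrix (Fin m) (Fin N) ℝ),
        IsGaussianMatrix P Φ v → 0 < P {ω | HasRIP (Φ ω) (2 * s) D} →
          C * ((s : ℝ) * Real.log ((N : ℝ) / (s : ℝ))) ≤ (m : ℝ)) ∧
    -- Count-Min type matrices
    (∀ (m N s k : ℕ) (D : ℝ) (Φ : Matrix (Fin m) (Fin N) ℝ),
      IsCountMinMatrix Φ k → HasRIP Φ s D →
        min ((s : ℝ) ^ 2 / D ^ 4) ((N : ℝ) / D ^ 2) ≤ (m : ℝ) ∧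
        ((s : ℝ) ^ 2 ≤ D ^ 2 * (N : ℝ) → (s : ℝ) ^ 2 / D ^ 4 ≤ (m : ℝ))) := by
  have key : ∀ D : ℝ, ∃ C : ℝ, 0 < C ∧ ∀ (m N s : ℕ) (Φ : Matrix (Fin m) (Fin N) ℝ),
      HasRIP Φ (2 * s) D → C * ((s : ℝ) * Real.log ((N : ℝ) / (s : ℝ))) ≤ (m : ℝ) := by
    intro D
    have hD : 1 ≤ max D 1 := le_max_right _ _
    have hlog : 0 < Real.log (1 + 3 * max D 1) := Real.log_pos (by linarith)
    exact ⟨_, by positivity, fun m N s Φ h => (h.mono (le_max_left D 1)).mul_log_le hD⟩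
  refine ⟨fun δ _ hδ1 => ?_, fun D => ?_, fun m N s k D Φ hΦ h => ⟨hΦ.min_le h, fun hsN => ?_⟩⟩
  · obtain ⟨C, hC, key⟩ := key √((1 + (1 + δ) / 2) / (1 - (1 + δ) / 2))
    refine ⟨C, hC, fun Ω _ P _ m N s v Φ _ hpos => ?_⟩
    -- an event of positive probability contains an outcome
    obtain ⟨ω, hω⟩ := nonempty_of_measure_ne_zero hpos.ne'
    have hω' : ric (Φ ω) (2 * s) ≤ δ := hω
    exact key m N s (Φ ω) (hasRIP_of_ric_lt (by linarith) (hω'.trans_lt (by linarith)))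
  · obtain ⟨C, hC, key⟩ := key D
    refine ⟨C, hC, fun Ω _ P _ m N s v Φ _ hpos => ?_⟩
    obtain ⟨ω, hω⟩ := nonempty_of_measure_ne_zero hpos.ne'
    exact key m N s (Φ ω) hω
  · rcases eq_or_ne D 0 with rfl | hD
    · simp
    · have hD2 : 0 < D ^ 2 := by positivity
      have hle : (s : ℝ) ^ 2 / D ^ 4 ≤ (N : ℝ) / D ^ 2 := by
        rw [div_le_div_iff₀ (by positivity) hD2]
        calc (s : ℝ) ^ 2 * D ^ 2 ≤ D ^ 2 * N * D ^ 2 := by gcongr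
          _ = N * D ^ 4 := by ring
      exact (min_eq_left hle).symm.le.trans (hΦ.min_le h)
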